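/- Let $M\ge 0$ be an integer, $G,G'\ge 1$ and $\kappa,\kappa'\in[0,1]$. Let $\mathcal L_\kappa$ denote the single-mode pure-loss channel of transmittance $\kappa$ (the mode is mixed with a vacuum environment mode on a beam splitter of transmittance $\kappa$, and the environment is traced out), and let $\mathcal A_G$ denote the single-mode quantum-limited amplifier of gain $G$ (the mode undergoes two-mode squeezing of gain $G$ with a vacuum environment mode, and the environment is traced out). Put $$\mathcal C=(\mathcal A_G\circ\mathcal L_\kappa)^{\otimes M},\qquad \mathcal C'=(\mathcal A_{G'}\circ\mathcal L_{\kappa'})^{\otimes M},$$ acting on a system $S$ of $M$ bosonic modes with Fock basis $|\mathbf n\rangle_S$, $\mathbf n=(n_1,\dots,n_M)\in\mathbb N^M$. Let $I$ be a system with Hilbert space $\mathcal H_I$, let $\{|\chi_{\mathbf n}\rangle_I\}_{\mathbf n\in\mathbb N^M}$ be an orthonormal family in $\mathcal H_I$, let $\{p_{\mathbf n}\}$ be a probability distribution on $\mathbb N^M$, and let $$|\psi\rangle_{IS}=\sum_{\mathbf n}\sqrt{p_{\mathbf n}}\,|\chi_{\mathbf n}\rangle_I|\mathbf n\rangle_S,\qquad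 \Psi=|\psi\rangle\langle\psi|_{IS}$$ be the corresponding number-diagonal-signal (NDS) probe. Let $p_n=\sum_{\mathbf n:\,n_1+\cdots+n_M=n}p_{\mathbf n}$ be the distribution of the total photon number in $S$. For the output states $\rho=(\mathrm{id}_I\otimes\mathcal C)(\Psi)$ and $\rho'=(\mathrm{id}_I\otimes\mathcal C')(\Psi)$, the fidelity $F(\rho,\rho')=\operatorname{Tr}\sqrt{\sqrt{\rho}\,\rho'\sqrt{\rho}}$ satisfies $$F(\rho,\rho')\;\ge\;\nu^M\sum_{n=0}^\infty p_n\left[\nu\sqrt{\kappa\kappa'}+\sqrt{(1-\kappa)(1-\kappa')}\right]^n,\qquad \nu=\left(\sqrt{GG'}-\sqrt{(G-1)(G'-1)}\right)^{-1}.$$ -/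

import Mathlib

open scoped InnerProductSpace Nat

noncomputable section

namespace Bosonic

/-! ### Hilbert spaces

`Fin M → ℕ` indexes the Fock (photon-number) basis of `M` bosonic modes.  The Hilbert space of
an idler system `H` together with `M` signal modes is `H ⊗ ℓ²(Fin M → ℕ)`, realised as the space
`ℓ²(Fin M → ℕ; H)` of square-summable `H`-valued families: `|χ⟩ ⊗ |𝐧⟩` is `lp.single 2 𝐧 χ`. -/

/-- The Hilbert space `H ⊗ ℓ²(X)`, as square-summable families `X → H`. -/
abbrev HilbertTensor (X : Type*) (H : Type*) [NormedAddCommGroup H] : Type _ :=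
  lp (fun _ : X => H) 2

/-- The Hilbert space of an idler `H` and `M` bosonic signal modes. -/
abbrev IdlerSignal (H : Type*) [NormedAddCommGroup H] (M : ℕ) : Type _ :=
  HilbertTensor (Fin M → ℕ) H

/-! ### Trace and fidelity -/

section Fidelity

variable {E : Type*} [NormedAddCommGroup E] [InnerProductSpace ℂ E] [CompleteSpace E]

/-- The trace `∑ᵢ ⟨eᵢ| T |eᵢ⟩` over a Hilbert basis.  For trace-class `T` the sum converges
absolutely and does not depend on the basis. -/
def trace (T : E →L[ℂ] E) : ℂ :=
  ∑' e : (exists_hilbertBasis ℂ E).choose, ⟪(e : E), T (e : E)⟫_ℂ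

/-- The fidelity `F(ρ, σ) = Tr √(√ρ σ √ρ)`. -/
def fidelity (ρ σ : E →L[ℂ] E) : ℝ :=
  (trace (CFC.sqrt (CFC.sqrt ρ * σ * CFC.sqrt ρ))).re

end Fidelity

/-! ### Two-mode dilations of the pure-loss channel and of the quantum-limited amplifier

A family `f : ℕ → ℕ → ℂ` is the table of Fock amplitudes `f j k = ⟨j, k | f⟩` of a vector of the
two-mode system formed by the signal mode (annihilation operator `a`) and the environment mode
(annihilation operator `e`). -/

/-- The creation operator `a†` of the signal mode. -/
def createS (f : ℕ → ℕ → ℂ) : ℕ → ℕ → ℂ := fun j k => (√(j : ℝ) : ℂ) * f (j - 1) k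

/-- The creation operator `e†` of the environment mode. -/
def createE (f : ℕ → ℕ → ℂ) : ℕ → ℕ → ℂ := fun j k => (√(k : ℝ) : ℂ) * f j (k - 1)

/-- The annihilation operator `e` of the environment mode. -/
def annihE (f : ℕ → ℕ → ℂ) : ℕ → ℕ → ℂ := fun j k => (√((k + 1 : ℕ) : ℝ) : ℂ) * f j (k + 1)

/-- The two-mode vacuum `|0, 0⟩`. -/
def vacuum : ℕ → ℕ → ℂ := fun j k => if j = 0 ∧ k = 0 then 1 else 0

/-- The two-mode squeezed vacuum `G^{-1/2} ∑ₖ ((G - 1)/G)^{k/2} |k, k⟩`, the image of the vacuum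
under the two-mode squeezing unitary of gain `G`. -/
def squeezedVacuum (G : ℝ) : ℕ → ℕ → ℂ :=
  fun j k => if j = k then (((√G)⁻¹ * √((G - 1) / G) ^ k : ℝ) : ℂ) else 0

/-- `U |n, 0⟩` for the beam-splitter unitary `U` of transmittance `κ`, for which
`U a† U† = √κ a† + √(1 - κ) e†` and `U |0, 0⟩ = |0, 0⟩`; so
`U |n, 0⟩ = (n!)^{-1/2} (√κ a† + √(1 - κ) e†)ⁿ |0, 0⟩`. -/
def lossDilation (κ : ℝ) (n : ℕ) : ℕ → ℕ → ℂ :=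
  ((√(n ! : ℝ))⁻¹ : ℂ) •
    (fun f => (√κ : ℂ) • createS f + (√(1 - κ) : ℂ) • createE f)^[n] vacuum

/-- `U |n, 0⟩` for the two-mode squeezing unitary `U` of gain `G`, for which
`U a† U† = √G a† - √(G - 1) e` (equivalently `U† a U = √G a + √(G - 1) e†`) and `U |0, 0⟩` is
the two-mode squeezed vacuum; so `U |n, 0⟩ = (n!)^{-1/2} (√G a† - √(G - 1) e)ⁿ U |0, 0⟩`. -/
def ampDilation (G : ℝ) (n : ℕ) : ℕ → ℕ → ℂ :=
  ((√(n ! : ℝ))⁻¹ : ℂ) •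
    (fun f => (√G : ℂ) • createS f - (√(G - 1) : ℂ) • annihE f)^[n] (squeezedVacuum G)

/-! ### Single-mode channels

A single-mode channel is given by a family of Kraus operators `K i`, each written in the Fock
basis: `K i m n = ⟨m| K i |n⟩`. -/

/-- The pure-loss channel `𝓛_κ`: the signal is mixed with a vacuum environment on a beam splitter
of transmittance `κ` and the environment is traced out, i.e. the Kraus operators are
`⟨l|_E U |0⟩_E`. -/
def lossKraus (κ : ℝ) : ℕ → ℕ → ℕ → ℂ := fun l m n => lossDilation κ n m l

/-- The quantum-limited amplifier `𝓐_G`: the signal undergoes two-mode squeezing of gain `G` with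
a vacuum environment and the environment is traced out. -/
def ampKraus (G : ℝ) : ℕ → ℕ → ℕ → ℂ := fun k m n => ampDilation G n m k

/-- The composition `𝓐 ∘ 𝓑` of two single-mode channels: its Kraus operators are the products
`A i * B j`. -/
def compKraus {ι ι' : Type*} (A : ι → ℕ → ℕ → ℂ) (B : ι' → ℕ → ℕ → ℂ) :
    ι × ι' → ℕ → ℕ → ℂ :=
  fun ij m n => ∑' r, A ij.1 m r * B ij.2 r n

/-- The `M`-fold tensor power of a single-mode channel: its Kraus operators are the tensor products
`K (i 1) ⊗ ⋯ ⊗ K (i M)`, written in the `M`-mode Fock basis. -/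
def tensorKraus {ι : Type*} (K : ι → ℕ → ℕ → ℂ) (M : ℕ) :
    (Fin M → ι) → (Fin M → ℕ) → (Fin M → ℕ) → ℂ :=
  fun i m n => ∏ s, K (i s) (m s) (n s)

/-! ### Action on operators of idler and signal -/

section Action

variable {X : Type*} [DecidableEq X]
variable (H : Type*) [NormedAddCommGroup H] [InnerProductSpace ℂ H]

/-- `T = id_H ⊗ A`, where `A` is the operator on `ℓ²(X)` with matrix `a`:
`T (|v⟩ ⊗ |n⟩) = ∑ₘ a m n |v⟩ ⊗ |m⟩`. -/
def IsIdTensor (a : X → X → ℂ) (T : HilbertTensor X H →L[ℂ] HilbertTensor X H) : Prop :=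
  ∀ (n : X) (v : H) (m : X), T (lp.single 2 n v) m = a m n • v

open Classical in
/-- The bounded operator `id_H ⊗ A`, where `A` is the operator on `ℓ²(X)` with matrix `a`; it is
unique (see `IsIdTensor.unique`), and for the Kraus operators used here it exists
(see `isIdTensor_cascade`).  The value is `0` if the matrix is not that of a bounded operator. -/
def idTensorOp (a : X → X → ℂ) : HilbertTensor X H →L[ℂ] HilbertTensor X H :=
  if h : ∃ T, IsIdTensor H a T then h.choose else 0

variable {H}

/-- The map `id_H ⊗ 𝓒`, `ρ ↦ ∑ᵢ (1 ⊗ Kᵢ) ρ (1 ⊗ Kᵢ)†`, where `𝓒` is the channel with Kraus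
operators `K i`.  For a density operator `ρ` and a trace-preserving `𝓒` the sum converges
absolutely in operator norm. -/
def applyChannel [CompleteSpace H] {ι : Type*} (K : ι → X → X → ℂ)
    (ρ : HilbertTensor X H →L[ℂ] HilbertTensor X H) :
    HilbertTensor X H →L[ℂ] HilbertTensor X H :=
  ∑' i, idTensorOp H (K i) ∘L ρ ∘L ContinuousLinearMap.adjoint (idTensorOp H (K i))

end Action

/-- The Kraus operators of the cascaded channel `(𝓐_G ∘ 𝓛_κ)^{⊗M}`. -/
def cascadeKraus (G κ : ℝ) (M : ℕ) :
    (Fin M → ℕ × ℕ) → (Fin M → ℕ) → (Fin M → ℕ) → ℂ :=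
  tensorKraus (compKraus (ampKraus G) (lossKraus κ)) M

/-! ### Well-definedness of the Kraus operators -/

section WellDefined

theorem IsIdTensor.unique {X : Type*} [DecidableEq X] {H : Type*} [NormedAddCommGroup H]
    [InnerProductSpace ℂ H] {a : X → X → ℂ} {S T : HilbertTensor X H →L[ℂ] HilbertTensor X H}
    (hS : IsIdTensor H a S) (hT : IsIdTensor H a T) : S = T := by
  ext1 f
  have h1 := (lp.hasSum_single (p := 2) (by simp) f).mapL S
  have h2 := (lp.hasSum_single (p := 2) (by simp) f).mapL T
  refine h1.unique (h2.congr_fun ?_)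
  intro n
  ext m
  rw [hS, hT]

theorem isIdTensor_idTensorOp {X : Type*} [DecidableEq X] {H : Type*} [NormedAddCommGroup H]
    [InnerProductSpace ℂ H] {a : X → X → ℂ} (h : ∃ T, IsIdTensor H a T) :
    IsIdTensor H a (idTensorOp H a) := by
  rw [idTensorOp, dif_pos h]
  exact h.choose_spec

/-- A matrix with entries of modulus at most one and at most one non-zero entry in each row and
column is that of a bounded operator. -/
theorem exists_isIdTensor {X : Type*} [DecidableEq X] (H : Type*) [NormedAddCommGroup H]
    [InnerProductSpace ℂ H] (a : X → X → ℂ) (hb : ∀ m n, ‖a m n‖ ≤ 1)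
    (hrow : ∀ m n n', a m n ≠ 0 → a m n' ≠ 0 → n = n')
    (hcol : ∀ m m' n, a m n ≠ 0 → a m' n ≠ 0 → m = m') :
    ∃ T, IsIdTensor H a T := by
  classical
  have hσ : ∀ m, ∃ s, ∀ n, n ≠ s → a m n = 0 := by
    intro m
    by_cases h : ∃ n, a m n ≠ 0
    · obtain ⟨s, hs⟩ := h
      exact ⟨s, fun n hn => by_contra fun h' => hn (hrow m n s h' hs)⟩
    · push Not at h
      exact ⟨m, fun n _ => h n⟩
  choose σ hσ using hσ
  have key : ∀ (f : HilbertTensor X H) (s : Finset X),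
      ∑ m ∈ s, ‖a m (σ m) • f (σ m)‖ ^ (2 : ENNReal).toReal ≤ ‖f‖ ^ (2 : ENNReal).toReal := by
    intro f s
    calc ∑ m ∈ s, ‖a m (σ m) • f (σ m)‖ ^ (2 : ENNReal).toReal
        = ∑ m ∈ s.filter (fun m => a m (σ m) ≠ 0),
            ‖a m (σ m) • f (σ m)‖ ^ (2 : ENNReal).toReal := by
          symm
          apply Finset.sum_filter_of_ne
          intro m _ h h0
          simp [h0] at h
      _ ≤ ∑ m ∈ s.filter (fun m => a m (σ m) ≠ 0), ‖f (σ m)‖ ^ (2 : ENNReal).toReal := by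
          apply Finset.sum_le_sum
          intro m _
          apply Real.rpow_le_rpow (norm_nonneg _) _ (by simp)
          rw [norm_smul]
          exact mul_le_of_le_one_left (norm_nonneg _) (hb _ _)
      _ = ∑ n ∈ (s.filter (fun m => a m (σ m) ≠ 0)).image σ,
            ‖f n‖ ^ (2 : ENNReal).toReal := by
          rw [Finset.sum_image]
          intro m hm m' hm' h
          simp only [Finset.coe_filter, Set.mem_ofPred_eq] at hm hm'
          exact hcol m m' (σ m) hm.2 (h ▸ hm'.2)
      _ ≤ _ := lp.sum_rpow_le_norm_rpow (by simp) f _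
  let L : HilbertTensor X H →ₗ[ℂ] HilbertTensor X H :=
    { toFun := fun f => ⟨fun m => a m (σ m) • f (σ m), memℓp_gen' (key f)⟩
      map_add' := by
        intro f g
        ext m
        exact smul_add _ _ _
      map_smul' := by
        intro c f
        ext m
        exact smul_comm _ _ _ }
  refine ⟨L.mkContinuous 1 fun f => ?_, fun n v m => ?_⟩
  · rw [one_mul]
    exact lp.norm_le_of_forall_sum_le (by simp) (norm_nonneg _) (key f)
  · change a m (σ m) • (lp.single 2 n v : HilbertTensor X H) (σ m) = _
    by_cases h : σ m = n
    · subst h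
      rw [lp.single_apply_self]
    · rw [lp.single_apply_ne _ _ _ h, hσ m n (Ne.symm h)]
      simp

theorem lossDilation_aux (x y : ℂ) (n m l : ℕ) :
    (fun f => x • createS f + y • createE f)^[n] vacuum m l =
      if m + l = n then (n ! : ℂ) * (((√(m ! : ℝ))⁻¹ * (√(l ! : ℝ))⁻¹ : ℝ) : ℂ) * x ^ m * y ^ l
      else 0 := by
  induction n generalizing m l with
  | zero =>
    rcases m with _ | m <;> rcases l with _ | l <;> simp [vacuum]
  | succ n ih =>
    have hs : ∀ k : ℕ, ((√((k : ℝ) + 1) : ℝ) : ℂ) * ((√((k : ℝ) + 1) : ℝ) : ℂ) = (k : ℂ) + 1 := by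
      intro k
      rw [← Complex.ofReal_mul, Real.mul_self_sqrt (by positivity)]
      simp
    have hn : ∀ k : ℕ, ((√((k : ℝ) + 1) : ℝ) : ℂ) ≠ 0 := by
      intro k
      exact_mod_cast (Real.sqrt_pos.2 (by positivity : (0 : ℝ) < (k : ℝ) + 1)).ne'
    have hf : ∀ k : ℕ, ((√(k ! : ℝ) : ℝ) : ℂ) ≠ 0 := by
      intro k
      exact_mod_cast (Real.sqrt_pos.2 (by positivity : (0 : ℝ) < (k ! : ℝ))).ne'
    rw [Function.iterate_succ_apply']
    simp only [Pi.add_apply, Pi.smul_apply, createS, createE, ih, smul_eq_mul]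
    rcases m with _ | m <;> rcases l with _ | l
    · simp
    · by_cases h : l = n
      · subst h
        have := hs l
        have := hn l
        have := hf l
        simp [Nat.factorial_succ, pow_succ]
        field_simp
        grind
      · simp [h]
    · by_cases h : m = n
      · subst h
        have := hs m
        have := hn m
        have := hf m
        simp [Nat.factorial_succ, pow_succ]
        field_simp
        grind
      · simp [h]
    · by_cases h : m + 1 + l = n
      · subst h
        have := hs l
        have := hn l
        have := hf l
        have := hs m
        have := hn m
        have := hf m
        have e1 : m + (l + 1) = m + 1 + l := by omega
        have e2 : m + 1 + (l + 1) = m + 1 + l + 1 := by omega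
        simp only [Nat.add_sub_cancel, e1, e2, if_true, Nat.factorial_succ]
        push_cast
        simp only [Real.sqrt_mul (by positivity : (0 : ℝ) ≤ (m : ℝ) + 1),
          Real.sqrt_mul (by positivity : (0 : ℝ) ≤ (l : ℝ) + 1), Complex.ofReal_mul, pow_succ]
        field_simp
        grind
      · have e1 : ¬ (m + (l + 1) = n) := by omega
        have e2 : ¬ (m + 1 + (l + 1) = n + 1) := by omega
        simp [h, e1, e2]

theorem sqrt_choose_eq (m l : ℕ) :
    √((m + l).choose l : ℝ) = √((m + l)! : ℝ) * (√(m ! : ℝ))⁻¹ * (√(l ! : ℝ))⁻¹ := by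
  have h : (((m + l).choose l : ℕ) : ℝ) = (m + l)! * (m ! : ℝ)⁻¹ * (l ! : ℝ)⁻¹ := by
    have := Nat.add_choose_mul_factorial_mul_factorial m l
    have h2 : ((m + l).choose l : ℝ) * m ! * l ! = (m + l)! := by exact_mod_cast this
    rw [← h2]
    field_simp
  rw [h, Real.sqrt_mul (by positivity), Real.sqrt_mul (by positivity), Real.sqrt_inv,
    Real.sqrt_inv]

/-- The beam-splitter amplitudes
`U |n, 0⟩ = ∑_{m + l = n} √(n choose l) κ^{m/2} (1 - κ)^{l/2} |m, l⟩`. -/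
theorem lossKraus_eq (κ : ℝ) (l m n : ℕ) :
    lossKraus κ l m n =
      if n = m + l then ((√((m + l).choose l : ℝ) * √κ ^ m * √(1 - κ) ^ l : ℝ) : ℂ) else 0 := by
  simp only [lossKraus, lossDilation, Pi.smul_apply, lossDilation_aux, smul_eq_mul]
  by_cases h : n = m + l
  · subst h
    have hf : ((√((m + l)! : ℝ) : ℝ) : ℂ) ≠ 0 := by
      exact_mod_cast (Real.sqrt_pos.2 (by positivity : (0 : ℝ) < ((m + l)! : ℝ))).ne'
    have hs : (((m + l)! : ℕ) : ℂ) = ((√((m + l)! : ℝ) : ℝ) : ℂ) * ((√((m + l)! : ℝ) : ℝ) : ℂ) := by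
      rw [← Complex.ofReal_mul, Real.mul_self_sqrt (by positivity)]
      simp
    simp only [if_true, sqrt_choose_eq]
    rw [hs]
    push_cast
    field_simp
  · simp [h, Ne.symm h]

theorem ampDilation_aux {G : ℝ} (hG : 1 ≤ G) (n m k : ℕ) :
    (fun f => (√G : ℂ) • createS f - (√(G - 1) : ℂ) • annihE f)^[n] (squeezedVacuum G) m k =
      if m = n + k then
        ((√((n + k)! : ℝ) * (√(k ! : ℝ))⁻¹ * (√G)⁻¹ ^ (n + 1) * √((G - 1) / G) ^ k : ℝ) : ℂ)
      else 0 := by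
  induction n generalizing m k with
  | zero =>
    have hf : √(k ! : ℝ) ≠ 0 := (Real.sqrt_pos.2 (by positivity)).ne'
    by_cases h : m = k
    · simp [squeezedVacuum, h, hf]
    · simp [squeezedVacuum, h]
  | succ n ih =>
    rw [Function.iterate_succ_apply']
    simp only [Pi.sub_apply, Pi.smul_apply, createS, annihE, ih, smul_eq_mul]
    by_cases h : m = n + 1 + k
    · subst h
      have e1 : n + 1 + k - 1 = n + k := by omega
      have e2 : n + 1 + k = n + (k + 1) := by omega
      have e3 : (n + 1 + k)! = (n + 1 + k) * (n + k)! := by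
        rw [show n + 1 + k = (n + k) + 1 by omega, Nat.factorial_succ]
      simp only [e1, if_true, ← e2]
      rw [← Complex.ofReal_mul, ← Complex.ofReal_mul, ← Complex.ofReal_mul, ← Complex.ofReal_mul,
        ← Complex.ofReal_sub, Complex.ofReal_inj, e3, Nat.factorial_succ]
      push_cast
      have hG0 : 0 < G := by linarith
      have hg : 0 < √G := Real.sqrt_pos.2 hG0
      have hgg : √G * √G = G := Real.mul_self_sqrt hG0.le
      have hh : √(G - 1) * √(G - 1) = G - 1 := Real.mul_self_sqrt (by linarith)
      have hk : 0 < √((k : ℝ) + 1) := Real.sqrt_pos.2 (by positivity)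
      have hf : 0 < √(k ! : ℝ) := Real.sqrt_pos.2 (by positivity)
      rw [Real.sqrt_mul (by positivity), Real.sqrt_mul (by positivity : (0 : ℝ) ≤ (k : ℝ) + 1),
        pow_succ √((G - 1) / G), Real.sqrt_div (by linarith), pow_succ (√G)⁻¹ (n + 1)]
      generalize (√(G - 1) / √G) ^ k = t
      generalize (√G)⁻¹ ^ (n + 1) = u
      field_simp
      grind
    · have e1 : ¬ (m = n + (k + 1)) := by omega
      rcases m with _ | m
      · simp [h]
      · have e2 : ¬ (m = n + k) := by omega
        simp only [Nat.add_sub_cancel, e1, e2, h, if_false]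
        simp

/-- The two-mode-squeezing amplitudes
`U |n, 0⟩ = G^{-(n+1)/2} ∑ₖ √(n+k choose k) ((G - 1)/G)^{k/2} |n + k, k⟩`. -/
theorem ampKraus_eq {G : ℝ} (hG : 1 ≤ G) (k m n : ℕ) :
    ampKraus G k m n =
      if m = n + k then
        ((√((n + k).choose k : ℝ) * (√G)⁻¹ ^ (n + 1) * √((G - 1) / G) ^ k : ℝ) : ℂ)
      else 0 := by
  simp only [ampKraus, ampDilation, Pi.smul_apply, ampDilation_aux hG, smul_eq_mul]
  by_cases h : m = n + k
  · simp only [h, if_true, sqrt_choose_eq]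
    push_cast
    ring
  · simp [h]

theorem sqrt_choose_mul_pow_le {u v : ℝ} (hu : 0 ≤ u) (hv : 0 ≤ v) (huv : u + v = 1) (m l : ℕ) :
    √((m + l).choose l : ℝ) * √u ^ m * √v ^ l ≤ 1 := by
  have h1 : ((m + l).choose l : ℝ) * u ^ m * v ^ l ≤ 1 := by
    have h := add_pow u v (m + l)
    rw [huv, one_pow] at h
    rw [h]
    have := Finset.single_le_sum (f := fun i => u ^ i * v ^ (m + l - i) * ((m + l).choose i : ℝ))
      (s := Finset.range (m + l + 1)) (fun i _ => by positivity)
      (Finset.mem_range.2 (by omega : m < m + l + 1))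
    refine le_trans (le_of_eq ?_) this
    simp only [Nat.add_sub_cancel_left]
    rw [Nat.choose_symm_add]
    ring
  refine (sq_le_one_iff₀ (by positivity)).1 (le_trans (le_of_eq ?_) h1)
  rw [mul_pow, mul_pow, ← pow_mul, ← pow_mul, mul_comm m, mul_comm l 2, pow_mul, pow_mul,
    Real.sq_sqrt hu, Real.sq_sqrt hv, Real.sq_sqrt (by positivity)]

theorem norm_lossKraus_le {κ : ℝ} (hκ : κ ∈ Set.Icc (0 : ℝ) 1) (l m n : ℕ) :
    ‖lossKraus κ l m n‖ ≤ 1 := by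
  rw [lossKraus_eq]
  split_ifs
  · rw [Complex.norm_real, Real.norm_of_nonneg (by positivity)]
    exact sqrt_choose_mul_pow_le hκ.1 (by linarith [hκ.2]) (by ring) m l
  · simp

theorem norm_ampKraus_le {G : ℝ} (hG : 1 ≤ G) (k m n : ℕ) : ‖ampKraus G k m n‖ ≤ 1 := by
  have hG0 : 0 < G := by linarith
  rw [ampKraus_eq hG]
  split_ifs
  · rw [Complex.norm_real, Real.norm_of_nonneg (by positivity)]
    have h := sqrt_choose_mul_pow_le (inv_nonneg.2 hG0.le)
      (div_nonneg (by linarith) hG0.le : 0 ≤ (G - 1) / G) (by field_simp; ring) n k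
    rw [Real.sqrt_inv] at h
    have h1 : (√G)⁻¹ ≤ 1 := inv_le_one_of_one_le₀ (Real.one_le_sqrt.2 hG)
    calc _ = (√((n + k).choose k : ℝ) * (√G)⁻¹ ^ n * √((G - 1) / G) ^ k) * (√G)⁻¹ := by
          rw [pow_succ]
          ring
      _ ≤ 1 := mul_le_one₀ h (by positivity) h1
  · simp

/-- Matrix elements of the single-mode Kraus operators of `𝓐_G ∘ 𝓛_κ`. -/
theorem compKraus_eq (G κ : ℝ) (i : ℕ × ℕ) (m n : ℕ) :
    compKraus (ampKraus G) (lossKraus κ) i m n =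
      ampKraus G i.1 m (n - i.2) * lossKraus κ i.2 (n - i.2) n := by
  refine tsum_eq_single (n - i.2) fun r hr => ?_
  rw [lossKraus_eq, if_neg (by omega), mul_zero]

theorem compKraus_ne_zero {G : ℝ} (hG : 1 ≤ G) {κ : ℝ} {i : ℕ × ℕ} {m n : ℕ}
    (h : compKraus (ampKraus G) (lossKraus κ) i m n ≠ 0) : m + i.2 = n + i.1 := by
  rw [compKraus_eq, lossKraus_eq, ampKraus_eq hG] at h
  by_contra hne
  apply h
  split_ifs <;> first | omega | simp

/-- The Kraus operators of `id ⊗ (𝓐_G ∘ 𝓛_κ)^{⊗M}` are bounded operators. -/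
theorem isIdTensor_cascade (H : Type*) [NormedAddCommGroup H] [InnerProductSpace ℂ H]
    {G κ : ℝ} (hG : 1 ≤ G) (hκ : κ ∈ Set.Icc (0 : ℝ) 1) (M : ℕ) (i : Fin M → ℕ × ℕ) :
    IsIdTensor H (cascadeKraus G κ M i) (idTensorOp H (cascadeKraus G κ M i)) := by
  apply isIdTensor_idTensorOp
  have hne : ∀ m n : Fin M → ℕ, cascadeKraus G κ M i m n ≠ 0 →
      ∀ s, m s + (i s).2 = n s + (i s).1 := by
    intro m n h s
    rw [cascadeKraus, tensorKraus] at h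
    exact compKraus_ne_zero hG (Finset.prod_ne_zero_iff.1 h s (Finset.mem_univ s))
  apply exists_isIdTensor
  · intro m n
    rw [cascadeKraus, tensorKraus, norm_prod]
    refine Finset.prod_le_one (fun _ _ => norm_nonneg _) fun s _ => ?_
    rw [compKraus_eq, norm_mul]
    exact mul_le_one₀ (norm_ampKraus_le hG _ _ _) (norm_nonneg _) (norm_lossKraus_le hκ _ _ _)
  · intro m n n' h h'
    funext s
    have := hne _ _ h s
    have := hne _ _ h' s
    omega
  · intro m m' n h h'
    funext s
    have := hne _ _ h s
    have := hne _ _ h' s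
    omega

end WellDefined

/-! ### Number-diagonal signal (NDS) probes -/

/-- The data of an NDS probe: a probability distribution `p` of the `M`-mode photon numbers and an
orthonormal family `χ` of idler states. -/
structure NDSProbe (H : Type*) [NormedAddCommGroup H] [InnerProductSpace ℂ H] (M : ℕ) where
  p : (Fin M → ℕ) → ℝ
  χ : (Fin M → ℕ) → H
  p_nonneg : ∀ n, 0 ≤ p n
  p_hasSum : HasSum p 1
  orthonormal : Orthonormal ℂ χ

namespace NDSProbe

variable {H : Type*} [NormedAddCommGroup H] [InnerProductSpace ℂ H] {M : ℕ}

theorem memℓp_ket (P : NDSProbe H M) :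
    Memℓp (fun n : Fin M → ℕ => ((√(P.p n) : ℝ) : ℂ) • P.χ n) 2 := by
  apply memℓp_gen
  refine P.p_hasSum.summable.congr fun n => ?_
  simp [norm_smul, P.orthonormal.1 n, abs_of_nonneg, Real.sq_sqrt (P.p_nonneg n)]

/-- The state vector `|ψ⟩ = ∑_𝐧 √(p_𝐧) |χ_𝐧⟩ |𝐧⟩`. -/
def ket (P : NDSProbe H M) : IdlerSignal H M :=
  ⟨fun n => ((√(P.p n) : ℝ) : ℂ) • P.χ n, P.memℓp_ket⟩

theorem hasSum_ket (P : NDSProbe H M) :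
    HasSum (fun n => ((√(P.p n) : ℝ) : ℂ) •
      (lp.single 2 n (P.χ n) : IdlerSignal H M)) P.ket := by
  have h := lp.hasSum_single (p := 2) (by simp) P.ket
  simpa only [ket, lp.single_smul] using h

/-- The density operator `Ψ = |ψ⟩⟨ψ|`. -/
def state (P : NDSProbe H M) : IdlerSignal H M →L[ℂ] IdlerSignal H M :=
  InnerProductSpace.rankOne ℂ P.ket P.ket

/-- The probability `p_n = ∑_{𝐧 : n₁ + ⋯ + n_M = n} p_𝐧` of `n` photons in total. -/
def totalPMF (P : NDSProbe H M) (n : ℕ) : ℝ :=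
  ∑ k ∈ Finset.piAntidiag Finset.univ n, P.p k

end NDSProbe

/-- `ν = (√(G G') - √((G - 1)(G' - 1)))⁻¹`. -/
def nu (G G' : ℝ) : ℝ := (√(G * G') - √((G - 1) * (G' - 1)))⁻¹

end Bosonic

end

noncomputable section

namespace Bosonic

/-! ### Hilbert–Schmidt sums -/

section HilbertSchmidt

open ContinuousLinearMap

variable {E F K : Type*} [NormedAddCommGroup E] [InnerProductSpace ℂ E]
  [NormedAddCommGroup F] [InnerProductSpace ℂ F] [CompleteSpace F]
  [NormedAddCommGroup K] [InnerProductSpace ℂ K] [CompleteSpace K]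
  {ι ι' : Type*}

/-! The bound is the easy half of Uhlmann's theorem, applied to the purifications in which the
environments record the same Kraus label `i`. Put v_i = K_i ψ and w_i = K'_i ψ, so that ρ = ∑
|v_i⟩⟨v_i| and ρ' = ∑ |w_i⟩⟨w_i|. Then F(ρ, ρ') ≥ Re ∑ ⟨v_i, w_i⟩
(`tsum_re_inner_le_fidelity_rankOne`). This is the only inequality; the overlap is then evaluated
exactly.

To get it, write ρ = L†L and ρ' = N†N with L† e_i = v_i and N† e_i = w_i, so the overlap is Re Tr(L
N†). Polar decomposition turns this trace into Tr(C B Z†), with C and Z contractions and B = √(√ρ ρ'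
√ρ). Cauchy–Schwarz for the Hilbert–Schmidt product bounds it by Tr B = F
(`tsum_re_inner_le_fidelity`).

For the overlap, orthonormality of the χ_𝐧 removes the terms between different 𝐧, and the weight of
p_𝐧 is ∑_{i,𝐦} K_i(𝐦,𝐧) K'_i(𝐦,𝐧). All entries are nonnegative, so the sums may be exchanged in
`ENNReal`, and the weight factors over the modes. In each mode the amplifier gives a negative
binomial series and the loss a binomial sum (`tsum_ampKraus_overlap`, `tsum_compKraus_overlap`). -/

theorem tsum_enorm_inner_sq (b : HilbertBasis ι ℂ E) (x : E) :
    ∑' i, ‖⟪b i, x⟫_ℂ‖ₑ ^ 2 = ‖x‖ₑ ^ 2 := by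
  have h := (b.hasSum_inner_mul_inner x x).mapL Complex.reCLM
  have h2 : HasSum (fun i => ‖⟪b i, x⟫_ℂ‖ ^ 2) (‖x‖ ^ 2) := by
    convert h using 1
    · funext i
      simp only [Complex.reCLM_apply]
      rw [← inner_conj_symm x (b i), ← Complex.normSq_eq_conj_mul_self, Complex.ofReal_re,
        Complex.normSq_eq_norm_sq]
    · simp only [Complex.reCLM_apply]
      exact norm_sq_eq_re_inner (𝕜 := ℂ) x
  have h3 := ENNReal.ofReal_tsum_of_nonneg (fun i => sq_nonneg ‖⟪b i, x⟫_ℂ‖) h2.summable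
  rw [h2.tsum_eq] at h3
  simpa only [ENNReal.ofReal_pow (norm_nonneg _), ofReal_norm] using h3.symm

/-- The analysis operator `x ↦ (⟨vᵢ, x⟩)ᵢ` of a square-summable family. -/
theorem exists_analysis (v : ι → E) (hv : Summable fun i => ‖v i‖ ^ 2) :
    ∃ L : E →L[ℂ] lp (fun _ : ι => ℂ) 2, ∀ x i, L x i = ⟪v i, x⟫_ℂ := by
  -- The constant is the Hilbert–Schmidt norm of the operator; Cauchy–Schwarz is applied in each
  -- coordinate.
  have key : ∀ x : E, ∀ t : Finset ι, ∑ i ∈ t, ‖⟪v i, x⟫_ℂ‖ ^ (2 : ENNReal).toReal ≤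
      (√(∑' i, ‖v i‖ ^ 2) * ‖x‖) ^ (2 : ENNReal).toReal := by
    intro x t
    simp only [ENNReal.toReal_ofNat, Real.rpow_ofNat]
    rw [mul_pow, Real.sq_sqrt (tsum_nonneg fun _ => sq_nonneg _)]
    calc ∑ i ∈ t, ‖⟪v i, x⟫_ℂ‖ ^ 2 ≤ ∑ i ∈ t, ‖v i‖ ^ 2 * ‖x‖ ^ 2 := by
          refine Finset.sum_le_sum fun i _ => ?_
          rw [← mul_pow]
          gcongr
          exact norm_inner_le_norm _ _
      _ ≤ _ := by
          rw [← Finset.sum_mul]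
          gcongr
          exact hv.sum_le_tsum _ fun _ _ => sq_nonneg _
  let T : E →ₗ[ℂ] lp (fun _ : ι => ℂ) 2 :=
    { toFun := fun x => ⟨fun i => ⟪v i, x⟫_ℂ, memℓp_gen' (key x)⟩
      map_add' := fun x y => by
        ext i
        exact inner_add_right _ _ _
      map_smul' := fun c x => by
        ext i
        exact inner_smul_right _ _ _ }
  exact ⟨T.mkContinuous _ fun x =>
    lp.norm_le_of_forall_sum_le (by simp) (by positivity) (key x), fun x i => rfl⟩

/-- If `‖S x‖ = ‖T x‖` for all `x`, then `S = C T` for a contraction `C`. -/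
theorem exists_contraction_comp_eq (S : E →L[ℂ] F) (T : E →L[ℂ] K) (h : ∀ x, ‖S x‖ = ‖T x‖) :
    ∃ C : K →L[ℂ] F, ‖C‖ ≤ 1 ∧ ∀ x, C (T x) = S x := by
  set W : Submodule ℂ K := (LinearMap.range T.toLinearMap).topologicalClosure
  have hmem : ∀ x, T x ∈ W := fun x =>
    Submodule.le_topologicalClosure _ (LinearMap.mem_range_self T.toLinearMap x)
  let e : E →ₗ[ℂ] W := T.toLinearMap.codRestrict W hmem
  have : CompleteSpace W :=
    (Submodule.isClosed_topologicalClosure _).completeSpace_coe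
  have hd : DenseRange e := by
    intro y
    rw [closure_subtype]
    have hy : (y : K) ∈ closure (Set.range T) := y.2
    convert hy using 2
    ext z
    constructor
    · rintro ⟨_, ⟨x, rfl⟩, rfl⟩
      exact ⟨x, rfl⟩
    · rintro ⟨x, rfl⟩
      exact ⟨_, ⟨x, rfl⟩, rfl⟩
  have hb : ∀ x, ‖S.toLinearMap x‖ ≤ 1 * ‖e x‖ := fun x => by
    rw [one_mul]
    exact (h x).le
  -- `C` sends T x to S x, extends by continuity to the closure of the range of `T`, and vanishes on
  -- the orthogonal complement.
  refine ⟨S.toLinearMap.extendOfNorm e ∘L W.orthogonalProjectionOnto, ?_, fun x => ?_⟩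
  · refine (opNorm_comp_le _ _).trans (mul_le_one₀ ?_ (norm_nonneg _) ?_)
    · exact LinearMap.opNorm_extendOfNorm_le hd zero_le_one hb
    · exact W.orthogonalProjectionOnto_norm_le
  · have : W.orthogonalProjectionOnto (T x) = e x :=
      Submodule.orthogonalProjectionOnto_mem_subspace_eq_self (e x)
    rw [comp_apply, this, LinearMap.extendOfNorm_eq hd ⟨1, hb⟩]
    rfl

variable [CompleteSpace E]

/-- The Hilbert–Schmidt norm of an operator and of its adjoint agree, in arbitrary bases. -/
theorem tsum_enorm_apply_sq_eq_adjoint (b : HilbertBasis ι ℂ E) (c : HilbertBasis ι' ℂ F)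
    (T : E →L[ℂ] F) :
    ∑' i, ‖T (b i)‖ₑ ^ 2 = ∑' j, ‖adjoint T (c j)‖ₑ ^ 2 := by
  simp_rw [← tsum_enorm_inner_sq c, ← tsum_enorm_inner_sq b]
  rw [ENNReal.tsum_comm]
  refine tsum_congr fun j => tsum_congr fun i => ?_
  rw [adjoint_inner_right, ← inner_conj_symm, RCLike.enorm_conj]

/-- Taking adjoints moves the contraction to the outside: the sum becomes that of C†R†, where C†
only shrinks each vector; a second adjoint returns to `R`. -/
theorem tsum_enorm_apply_contraction_sq_le (b : HilbertBasis ι ℂ E) (c : HilbertBasis ι' ℂ F)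
    (R : F →L[ℂ] K) {C : E →L[ℂ] F} (hC : ‖C‖ ≤ 1) :
    ∑' i, ‖R (C (b i))‖ₑ ^ 2 ≤ ∑' j, ‖R (c j)‖ₑ ^ 2 := by
  obtain ⟨w, g, -⟩ := exists_hilbertBasis ℂ K
  have h := tsum_enorm_apply_sq_eq_adjoint b g (R ∘L C)
  simp only [adjoint_comp, comp_apply] at h
  rw [h, tsum_enorm_apply_sq_eq_adjoint c g R]
  refine ENNReal.tsum_le_tsum fun k => ?_
  gcongr
  rw [← ofReal_norm, ← ofReal_norm]
  apply ENNReal.ofReal_le_ofReal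
  refine (le_opNorm _ _).trans (mul_le_of_le_one_left (norm_nonneg _) ?_)
  rwa [LinearIsometryEquiv.norm_map]

/-- Both squares equal ⟨x, T†T x⟩. With `exists_contraction_comp_eq` this serves as the polar
decomposition. -/
theorem norm_sqrt_adjoint_comp_self_apply (T : E →L[ℂ] F) (x : E) :
    ‖CFC.sqrt (adjoint T ∘L T) x‖ = ‖T x‖ := by
  have hp : (0 : E →L[ℂ] E) ≤ adjoint T ∘L T :=
    (nonneg_iff_isPositive _).2 (isPositive_adjoint_comp_self T)
  have hs := ((nonneg_iff_isPositive _).1 (CFC.sqrt_nonneg (adjoint T ∘L T)))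
  rw [← sq_eq_sq₀ (norm_nonneg _) (norm_nonneg _), norm_sq_eq_re_inner (𝕜 := ℂ),
    hs.inner_left_eq_inner_right, ← mul_apply_eq_comp, CFC.sqrt_mul_sqrt_self _ hp, comp_apply,
    adjoint_inner_right, ← norm_sq_eq_re_inner]

/-- The fidelity of `L† L` and `N† N` is at least the real part of `Tr (L N†)`. -/
theorem tsum_re_inner_le_fidelity (b : HilbertBasis ι ℂ F) (L N : E →L[ℂ] F)
    (hL : ∑' i, ‖adjoint L (b i)‖ₑ ^ 2 ≠ ⊤) (hN : ∑' i, ‖adjoint N (b i)‖ₑ ^ 2 ≠ ⊤) :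
    ∑' i, (⟪adjoint L (b i), adjoint N (b i)⟫_ℂ).re ≤
      fidelity (adjoint L ∘L L) (adjoint N ∘L N) := by
  set r := CFC.sqrt (adjoint L ∘L L) with hr
  set s := CFC.sqrt (adjoint N ∘L N) with hs
  have hσ : (0 : E →L[ℂ] E) ≤ adjoint N ∘L N :=
    (nonneg_iff_isPositive _).2 (isPositive_adjoint_comp_self N)
  have hra : adjoint r = r :=
    ((nonneg_iff_isPositive _).1 (CFC.sqrt_nonneg (adjoint L ∘L L))).isSelfAdjoint.adjoint_eq
  have hsa : adjoint s = s :=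
    ((nonneg_iff_isPositive _).1 (CFC.sqrt_nonneg (adjoint N ∘L N))).isSelfAdjoint.adjoint_eq
  have hA : r * (adjoint N ∘L N) * r = adjoint (s ∘L r) ∘L (s ∘L r) := by
    rw [← CFC.sqrt_mul_sqrt_self _ hσ, adjoint_comp, hra, hsa]
    rfl
  set B := CFC.sqrt (r * (adjoint N ∘L N) * r) with hB
  have hB0 : 0 ≤ B := CFC.sqrt_nonneg _
  set R := CFC.sqrt B with hR
  have hRa : adjoint R = R :=
    ((nonneg_iff_isPositive _).1 (CFC.sqrt_nonneg B)).isSelfAdjoint.adjoint_eq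
  have hRR : ∀ x, R (R x) = B x := fun x => by
    rw [← mul_apply_eq_comp, hR, CFC.sqrt_mul_sqrt_self _ hB0]
  have hBn : ∀ x, ‖B x‖ = ‖(s ∘L r) x‖ := fun x => by
    rw [hB, hA, norm_sqrt_adjoint_comp_self_apply]
  obtain ⟨C, hC, hCL⟩ := exists_contraction_comp_eq L r
    (fun x => (norm_sqrt_adjoint_comp_self_apply L x).symm)
  obtain ⟨D, hD, hDN⟩ := exists_contraction_comp_eq N s
    (fun x => (norm_sqrt_adjoint_comp_self_apply N x).symm)
  -- `B` is the modulus of s r, so each factors through the other: s r = U B rewrites the overlap,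
  -- and B = U' s r shows that `B` is trace class.
  obtain ⟨U, hU, hUB⟩ := exists_contraction_comp_eq (s ∘L r) B (fun x => (hBn x).symm)
  obtain ⟨U', hU', hUB'⟩ := exists_contraction_comp_eq B (s ∘L r) hBn
  have hC' : ‖adjoint C‖ ≤ 1 := by rwa [LinearIsometryEquiv.norm_map]
  have hUD' : ‖adjoint U ∘L adjoint D‖ ≤ 1 := by
    refine (opNorm_comp_le _ _).trans (mul_le_one₀ ?_ (norm_nonneg _) ?_) <;>
      rwa [LinearIsometryEquiv.norm_map]
  have hLa : ∀ y, adjoint L y = r (adjoint C y) := fun y => by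
    have : C ∘L r = L := ext hCL
    rw [← this, adjoint_comp, hra, comp_apply]
  have hNa : ∀ y, adjoint N y = s (adjoint D y) := fun y => by
    have : D ∘L s = N := ext hDN
    rw [← this, adjoint_comp, hsa, comp_apply]
  obtain ⟨g, hg⟩ := (exists_hilbertBasis ℂ E).choose_spec
  have hnB : ∀ e, ⟪(e : E), B e⟫_ℂ = ((‖R e‖ ^ 2 : ℝ) : ℂ) := fun e => by
    rw [← hRR, ← adjoint_inner_left, hRa, inner_self_eq_norm_sq_to_K]
    simp
  have hr2 : ∑' e, ‖r (g e)‖ₑ ^ 2 ≠ ⊤ := by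
    have : ∀ e, ‖r (g e)‖ₑ = ‖L (g e)‖ₑ := fun e => by
      rw [← ofReal_norm, hr, norm_sqrt_adjoint_comp_self_apply, ofReal_norm]
    simp_rw [this]
    rwa [tsum_enorm_apply_sq_eq_adjoint g b]
  have hs2 : ∑' e, ‖s (adjoint U' (g e))‖ₑ ^ 2 ≠ ⊤ := by
    have : ∀ e, ‖s (g e)‖ₑ = ‖N (g e)‖ₑ := fun e => by
      rw [← ofReal_norm, hs, norm_sqrt_adjoint_comp_self_apply, ofReal_norm]
    refine ne_top_of_le_ne_top ?_ (tsum_enorm_apply_contraction_sq_le g g s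
      (C := adjoint U') (by rwa [LinearIsometryEquiv.norm_map]))
    simp_rw [this]
    rwa [tsum_enorm_apply_sq_eq_adjoint g b]
  have toReal : ∀ {α : Type _} {V : Type _} [NormedAddCommGroup V] (f : α → V),
      ∑' a, ‖f a‖ₑ ^ 2 ≠ ⊤ → Summable fun a => ‖f a‖ ^ 2 := by
    intro α V _ f hf
    simpa using ENNReal.summable_toReal hf
  -- Here ‖R e‖² = ⟨e, B e⟩ = ⟨s U'† e, r e⟩, and both s U'† and r are Hilbert–Schmidt. Without
  -- summability the `tsum` in `trace` would take the default value 0.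
  have hRsum : Summable fun e => ‖R (g e)‖ ^ 2 := by
    refine Summable.of_nonneg_of_le (fun _ => sq_nonneg _) (fun e => ?_)
      ((toReal _ hs2).add (toReal _ hr2))
    have h1 : ‖R (g e)‖ ^ 2 = ‖⟪s (adjoint U' (g e)), r (g e)⟫_ℂ‖ := by
      have h2 : ⟪g e, B (g e)⟫_ℂ = ⟪s (adjoint U' (g e)), r (g e)⟫_ℂ := by
        rw [← hUB', ← adjoint_inner_left, comp_apply, ← adjoint_inner_left, hsa]
      rw [← h2, hnB, Complex.norm_real, Real.norm_of_nonneg (sq_nonneg _)]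
    rw [h1]
    have := norm_inner_le_norm (𝕜 := ℂ) (s (adjoint U' (g e))) (r (g e))
    nlinarith [sq_nonneg (‖s (adjoint U' (g e))‖ - ‖r (g e)‖),
      sq_nonneg ‖s (adjoint U' (g e))‖, sq_nonneg ‖r (g e)‖]
  have hfid : fidelity (adjoint L ∘L L) (adjoint N ∘L N) = ∑' e, ‖R (g e)‖ ^ 2 := by
    change (trace B).re = _
    rw [trace]
    simp_rw [hnB]
    rw [← Complex.ofReal_tsum, Complex.ofReal_re, hg]
  have hfin : ENNReal.ofReal (∑' e, ‖R (g e)‖ ^ 2) = ∑' e, ‖R (g e)‖ₑ ^ 2 := by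
    rw [ENNReal.ofReal_tsum_of_nonneg (fun _ => sq_nonneg _) hRsum]
    simp only [ENNReal.ofReal_pow (norm_nonneg _), ofReal_norm]
  have bound : ∀ {Z : F →L[ℂ] E}, ‖Z‖ ≤ 1 → ∀ t : Finset ι,
      ∑ i ∈ t, ‖R (Z (b i))‖ ^ 2 ≤ ∑' e, ‖R (g e)‖ ^ 2 := by
    intro Z hZ t
    rw [← ENNReal.ofReal_le_ofReal_iff (tsum_nonneg fun _ => sq_nonneg _), hfin]
    refine le_trans ?_ (tsum_enorm_apply_contraction_sq_le b g R hZ)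
    rw [ENNReal.ofReal_sum_of_nonneg fun _ _ => sq_nonneg _]
    simp only [ENNReal.ofReal_pow (norm_nonneg _), ofReal_norm]
    exact ENNReal.sum_le_tsum t
  rw [hfid]
  -- Bounding finite partial sums by a nonnegative number suffices, since a divergent `tsum` is 0.
  refine tsum_le_of_sum_le' (tsum_nonneg fun _ => sq_nonneg _) fun t => ?_
  have key : ∀ i, (⟪adjoint L (b i), adjoint N (b i)⟫_ℂ).re ≤
      (‖R (adjoint C (b i))‖ ^ 2 + ‖R ((adjoint U ∘L adjoint D) (b i))‖ ^ 2) / 2 := by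
    intro i
    -- L N† = C r s D† = C B U† D†, and B = R R is split evenly between the two sides.
    have h1 : ⟪adjoint L (b i), adjoint N (b i)⟫_ℂ =
        ⟪R (adjoint C (b i)), R ((adjoint U ∘L adjoint D) (b i))⟫_ℂ := by
      rw [hLa, hNa, ← adjoint_inner_left s, hsa, ← comp_apply s r, ← hUB,
        ← adjoint_inner_right U, ← hRR, ← adjoint_inner_right R, hRa, comp_apply]
    rw [h1]
    have h2 := re_inner_le_norm (𝕜 := ℂ) (R (adjoint C (b i)))
      (R ((adjoint U ∘L adjoint D) (b i)))
    simp only [RCLike.re_eq_complex_re] at h2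
    nlinarith [sq_nonneg (‖R (adjoint C (b i))‖ - ‖R ((adjoint U ∘L adjoint D) (b i))‖)]
  refine (Finset.sum_le_sum fun i _ => key i).trans ?_
  rw [← Finset.sum_div, Finset.sum_add_distrib]
  linarith [bound hC' t, bound hUD' t]

/-- The fidelity of two ensembles of vectors is at least the real part of the overlap of the
purifications with matching labels. -/
theorem tsum_re_inner_le_fidelity_rankOne (v w : ι → E) (hv : Summable fun i => ‖v i‖ ^ 2)
    (hw : Summable fun i => ‖w i‖ ^ 2) :
    ∑' i, (⟪v i, w i⟫_ℂ).re ≤ fidelity (∑' i, InnerProductSpace.rankOne ℂ (v i) (v i))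
      (∑' i, InnerProductSpace.rankOne ℂ (w i) (w i)) := by
  classical
  let b : HilbertBasis ι ℂ (lp (fun _ : ι => ℂ) 2) :=
    HilbertBasis.ofRepr (LinearIsometryEquiv.refl ℂ _)
  have hb : ∀ i, b i = lp.single 2 i (1 : ℂ) := fun i => rfl
  have main : ∀ u : ι → E, (Summable fun i => ‖u i‖ ^ 2) →
      ∃ L : E →L[ℂ] lp (fun _ : ι => ℂ) 2, (∀ i, adjoint L (b i) = u i) ∧
        ∑' i, InnerProductSpace.rankOne ℂ (u i) (u i) = adjoint L ∘L L ∧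
        ∑' i, ‖adjoint L (b i)‖ₑ ^ 2 ≠ ⊤ := by
    intro u hu
    obtain ⟨L, hL⟩ := exists_analysis u hu
    have h1 : ∀ i, adjoint L (b i) = u i := by
      intro i
      refine ext_inner_right ℂ fun x => ?_
      rw [adjoint_inner_left, hb, lp.inner_single_left, hL]
      simp
    refine ⟨L, h1, ?_, ?_⟩
    -- The operator norm of |u⟩⟨u| is ‖u‖², so the series converges absolutely.
    · have hs : Summable fun i => InnerProductSpace.rankOne ℂ (u i) (u i) := by
        refine Summable.of_norm ?_
        simpa only [InnerProductSpace.norm_rankOne, ← sq] using hu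
      refine ext fun x => ext_inner_left ℂ fun y => ?_
      have h2 : HasSum (fun i => ⟪y, InnerProductSpace.rankOne ℂ (u i) (u i) x⟫_ℂ)
          ⟪y, (∑' i, InnerProductSpace.rankOne ℂ (u i) (u i)) x⟫_ℂ :=
        (hs.hasSum.mapL (ContinuousLinearMap.apply ℂ E x)).mapL (innerSL ℂ y)
      have h3 := lp.hasSum_inner (𝕜 := ℂ) (L y) (L x)
      rw [comp_apply, adjoint_inner_right]
      refine h2.unique (h3.congr_fun fun i => ?_)
      rw [hL, hL, InnerProductSpace.rankOne_apply, inner_smul_right, RCLike.inner_apply,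
        inner_conj_symm]
    · simp_rw [h1]
      have h3 := ENNReal.ofReal_tsum_of_nonneg (fun i => sq_nonneg ‖u i‖) hu
      simp only [ENNReal.ofReal_pow (norm_nonneg _), ofReal_norm] at h3
      rw [← h3]
      exact ENNReal.ofReal_ne_top
  obtain ⟨L, hL1, hL2, hL3⟩ := main v hv
  obtain ⟨N, hN1, hN2, hN3⟩ := main w hw
  have := tsum_re_inner_le_fidelity b L N hL3 hN3
  simp_rw [hL1, hN1] at this
  rwa [hL2, hN2]

end HilbertSchmidt

/-! ### Overlaps of the output vectors -/

section Overlap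

open scoped ENNReal

/-- Passage from complex inner products to `ENNReal`, where sums can be reordered freely. -/
theorem hasSum_ofReal_nonneg {α : Type*} {g : α → ℝ} {z : ℂ} (hg : ∀ a, 0 ≤ g a)
    (h : HasSum (fun a => (g a : ℂ)) z) :
    z = (z.re : ℂ) ∧ 0 ≤ z.re ∧ ENNReal.ofReal z.re = ∑' a, ENNReal.ofReal (g a) := by
  have hre : HasSum g z.re := by simpa using h.mapL Complex.reCLM
  have hz : z = (z.re : ℂ) := h.unique (by exact_mod_cast hre)
  refine ⟨hz, hre.nonneg hg, ?_⟩
  rw [← hre.tsum_eq, ENNReal.ofReal_tsum_of_nonneg hg hre.summable]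

theorem tsum_pi_prod {ι : Type*} {M : ℕ} (f : Fin M → ι → ℝ≥0∞) :
    ∑' i : Fin M → ι, ∏ s, f s (i s) = ∏ s, ∑' i, f s i := by
  induction M with
  | zero => simp
  | succ M ih =>
    rw [← (Fin.consEquiv fun _ => ι).tsum_eq, ENNReal.tsum_prod', Fin.prod_univ_succ,
      ← ih, ← ENNReal.tsum_mul_right]
    refine tsum_congr fun a => ?_
    rw [← ENNReal.tsum_mul_left]
    refine tsum_congr fun i => ?_
    simp [Fin.consEquiv, Fin.prod_univ_succ]

theorem tsum_eq_tsum_sum_piAntidiag {M : ℕ} (f : (Fin M → ℕ) → ℝ≥0∞) :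
    ∑' n, f n = ∑' N, ∑ n ∈ Finset.piAntidiag Finset.univ N, f n := by
  have h : ∀ n, f n = ∑' N, if ∑ s, n s = N then f n else 0 := fun n => by
    simp [eq_comm (a := ∑ s, n s)]
  rw [tsum_congr h, ENNReal.tsum_comm]
  refine tsum_congr fun N => ?_
  rw [tsum_eq_sum (s := Finset.piAntidiag Finset.univ N)]
  · refine Finset.sum_congr rfl fun n hn => ?_
    rw [if_pos (Finset.mem_piAntidiag.1 hn).1]
  · intro n hn
    rw [if_neg]
    intro h
    exact hn (Finset.mem_piAntidiag.2 ⟨h, by simp⟩)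

/-! ### Overlaps of operator images of an NDS probe -/

variable {H : Type*} [NormedAddCommGroup H] [InnerProductSpace ℂ H] {M : ℕ}

theorem IsIdTensor.inner_χ_apply_ket (P : NDSProbe H M) {a : (Fin M → ℕ) → (Fin M → ℕ) → ℂ}
    {T : IdlerSignal H M →L[ℂ] IdlerSignal H M} (hT : IsIdTensor H a T) (m n : Fin M → ℕ) :
    ⟪P.χ n, T P.ket m⟫_ℂ = (√(P.p n) : ℂ) * a m n := by
  have h1 := ((P.hasSum_ket.mapL T).mapL (lp.evalCLM ℂ (fun _ => H) 2 m)).mapL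
    (innerSL ℂ (P.χ n))
  have h2 : ∀ n', innerSL ℂ (P.χ n) (lp.evalCLM ℂ (fun _ => H) 2 m
      (T (((√(P.p n') : ℝ) : ℂ) • (lp.single 2 n' (P.χ n') : IdlerSignal H M)))) =
      (√(P.p n') : ℂ) * (a m n' * ⟪P.χ n, P.χ n'⟫_ℂ) := fun n' => by
    rw [map_smul, map_smul, map_smul, smul_eq_mul, ← inner_smul_right, ← hT n' (P.χ n') m]
    rfl
  refine h1.unique ?_
  simp_rw [h2, orthonormal_iff_ite.1 P.orthonormal]
  refine (hasSum_ite_eq n ((√(P.p n) : ℂ) * a m n)).congr_fun fun n' => ?_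
  by_cases h : n' = n
  · simp [h]
  · simp [h, Ne.symm h]

/-- The overlap of two images of an NDS probe, for matrices with nonnegative entries. -/
theorem ofReal_re_inner_apply_ket (P : NDSProbe H M) {a a' : (Fin M → ℕ) → (Fin M → ℕ) → ℂ}
    {T T' : IdlerSignal H M →L[ℂ] IdlerSignal H M} (hT : IsIdTensor H a T)
    (hT' : IsIdTensor H a' T') (ha : ∀ m n, a m n = (‖a m n‖ : ℂ))
    (ha' : ∀ m n, a' m n = (‖a' m n‖ : ℂ)) :
    0 ≤ (⟪T P.ket, T' P.ket⟫_ℂ).re ∧ ENNReal.ofReal (⟪T P.ket, T' P.ket⟫_ℂ).re =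
      ∑' n, ENNReal.ofReal (P.p n) * ∑' m, ‖a m n‖ₑ * ‖a' m n‖ₑ := by
  have h1 : ∀ n, HasSum (fun m => ((‖a m n‖ * (√(P.p n) * ‖a' m n‖) : ℝ) : ℂ))
      ⟪T (lp.single 2 n (P.χ n)), T' P.ket⟫_ℂ := by
    intro n
    refine (lp.hasSum_inner (𝕜 := ℂ) _ _).congr_fun fun m => ?_
    rw [hT n, inner_smul_left, hT'.inner_χ_apply_ket, ha m n, ha' m n]
    simp
  have h2 : ∀ n, _ := fun n => hasSum_ofReal_nonneg (fun m => by positivity) (h1 n)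
  have h3 : HasSum (fun n => ((√(P.p n) *
      (⟪T (lp.single 2 n (P.χ n)), T' P.ket⟫_ℂ).re : ℝ) : ℂ)) ⟪T P.ket, T' P.ket⟫_ℂ := by
    have := ((P.hasSum_ket.mapL T).mapL (innerSL ℂ (T' P.ket))).map (starRingEnd ℂ)
      Complex.continuous_conj
    simp only [innerSL_apply_apply, inner_conj_symm] at this
    refine this.congr_fun fun n => ?_
    rw [Complex.ofReal_mul, ← (h2 n).1]
    rw [Function.comp_apply, inner_conj_symm, map_smul, inner_smul_left, Complex.conj_ofReal]
  obtain ⟨-, h4, h5⟩ :=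
    hasSum_ofReal_nonneg (fun n => mul_nonneg (Real.sqrt_nonneg _) (h2 n).2.1) h3
  refine ⟨h4, h5.trans (tsum_congr fun n => ?_)⟩
  rw [ENNReal.ofReal_mul (Real.sqrt_nonneg _), (h2 n).2.2, ← ENNReal.tsum_mul_left,
    ← ENNReal.tsum_mul_left]
  refine tsum_congr fun m => ?_
  rw [ENNReal.ofReal_mul (norm_nonneg _), ENNReal.ofReal_mul (Real.sqrt_nonneg _),
    ofReal_norm, ofReal_norm]
  nth_rw 3 [← Real.mul_self_sqrt (P.p_nonneg n)]
  rw [ENNReal.ofReal_mul (Real.sqrt_nonneg _)]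
  ring

/-! ### Closed forms of the Kraus overlaps -/

theorem nu_pos {G G' : ℝ} (hG : 1 ≤ G) (hG' : 1 ≤ G') : 0 < nu G G' := by
  apply inv_pos.2
  apply sub_pos.2
  apply Real.sqrt_lt_sqrt
  · exact mul_nonneg (by linarith) (by linarith)
  · nlinarith

theorem enorm_ofReal_mul_of_nonneg {x y : ℝ} (hx : 0 ≤ x) (hy : 0 ≤ y) :
    ‖(x : ℂ)‖ₑ * ‖(y : ℂ)‖ₑ = ENNReal.ofReal (x * y) := by
  rw [← ofReal_norm, ← ofReal_norm, Complex.norm_of_nonneg hx, Complex.norm_of_nonneg hy,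
    ENNReal.ofReal_mul hx]

/-- Only m = r + k contributes, leaving (GG')^{-(r+1)/2} ∑ₖ (k+r choose r) xᵏ. The series sums to (1
- x)^{-(r+1)}, and √(GG') (1 - x) = ν⁻¹. -/
theorem tsum_ampKraus_overlap {G G' : ℝ} (hG : 1 ≤ G) (hG' : 1 ≤ G') (r : ℕ) :
    ∑' k, ∑' m, ‖ampKraus G k m r‖ₑ * ‖ampKraus G' k m r‖ₑ =
      ENNReal.ofReal (nu G G' ^ (r + 1)) := by
  have hG0 : 0 < G := by linarith
  have hG0' : 0 < G' := by linarith
  set x := √((G - 1) / G) * √((G' - 1) / G') with hx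
  have hx0 : 0 ≤ x := by positivity
  have hx' : x = √((G - 1) * (G' - 1)) / √(G * G') := by
    rw [hx, Real.sqrt_div (by linarith), Real.sqrt_div (by linarith),
      Real.sqrt_mul (by linarith), Real.sqrt_mul hG0.le]
    field_simp
  have hq : 0 < √(G * G') := Real.sqrt_pos.2 (by positivity)
  have hx1 : x < 1 := by
    rw [hx', div_lt_one hq]
    exact Real.sqrt_lt_sqrt (mul_nonneg (by linarith) (by linarith)) (by nlinarith)
  have h1 : ∀ k, ∑' m, ‖ampKraus G k m r‖ₑ * ‖ampKraus G' k m r‖ₑ =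
      ENNReal.ofReal ((√(G * G'))⁻¹ ^ (r + 1) * (((k + r).choose r : ℝ) * x ^ k)) := by
    intro k
    rw [tsum_eq_single (r + k)]
    · rw [ampKraus_eq hG, ampKraus_eq hG', if_pos rfl, if_pos rfl,
        enorm_ofReal_mul_of_nonneg (by positivity) (by positivity)]
      congr 1
      rw [hx, Real.sqrt_mul hG0.le, mul_inv, mul_pow, mul_pow, add_comm k r,
        Nat.choose_symm_add (a := r) (b := k)]
      linear_combination (√G)⁻¹ ^ (r + 1) * (√G')⁻¹ ^ (r + 1) * (√((G - 1) / G) ^ k *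
        √((G' - 1) / G') ^ k) * Real.mul_self_sqrt (Nat.cast_nonneg ((r + k).choose k))
    · intro m hm
      rw [ampKraus_eq hG, if_neg hm]
      simp
  have hs := (hasSum_choose_mul_geometric_of_norm_lt_one (𝕜 := ℝ) r (r := x)
    (by rwa [Real.norm_of_nonneg hx0])).mul_left ((√(G * G'))⁻¹ ^ (r + 1))
  rw [tsum_congr h1, ← ENNReal.ofReal_tsum_of_nonneg (fun k => by positivity) hs.summable,
    hs.tsum_eq]
  congr 1
  rw [one_div, ← inv_pow, ← mul_pow, ← mul_inv, nu, hx', mul_sub, mul_one,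
    mul_div_cancel₀ _ hq.ne']

/-- If l photons are lost, n - l enter the amplifier and contribute ν^{n-l+1}. The binomial theorem
over l gives the n-th power; the extra ν comes from the vacuum amplification. -/
theorem tsum_compKraus_overlap {G G' κ κ' : ℝ} (hG : 1 ≤ G) (hG' : 1 ≤ G')
    (hκ : κ ∈ Set.Icc (0 : ℝ) 1) (n : ℕ) :
    ∑' i, ∑' m, ‖compKraus (ampKraus G) (lossKraus κ) i m n‖ₑ *
        ‖compKraus (ampKraus G') (lossKraus κ') i m n‖ₑ =
      ENNReal.ofReal (nu G G' * (nu G G' * √(κ * κ') + √((1 - κ) * (1 - κ'))) ^ n) := by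
  have hν := (nu_pos hG hG').le
  simp_rw [compKraus_eq, enorm_mul]
  rw [ENNReal.tsum_prod', ENNReal.tsum_comm]
  have h1 : ∀ l, ∑' k, ∑' m, ‖ampKraus G k m (n - l)‖ₑ * ‖lossKraus κ l (n - l) n‖ₑ *
      (‖ampKraus G' k m (n - l)‖ₑ * ‖lossKraus κ' l (n - l) n‖ₑ) =
      (‖lossKraus κ l (n - l) n‖ₑ * ‖lossKraus κ' l (n - l) n‖ₑ) *
        ENNReal.ofReal (nu G G' ^ (n - l + 1)) := by
    intro l
    rw [← tsum_ampKraus_overlap hG hG', ← ENNReal.tsum_mul_left]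
    refine tsum_congr fun k => ?_
    rw [← ENNReal.tsum_mul_left]
    refine tsum_congr fun m => ?_
    ring
  dsimp only
  rw [tsum_congr h1, tsum_eq_sum (s := Finset.range (n + 1))]
  · have h2 : ∀ l ∈ Finset.range (n + 1),
        (‖lossKraus κ l (n - l) n‖ₑ * ‖lossKraus κ' l (n - l) n‖ₑ) *
          ENNReal.ofReal (nu G G' ^ (n - l + 1)) =
        ENNReal.ofReal (nu G G' * (√((1 - κ) * (1 - κ')) ^ l *
          (nu G G' * √(κ * κ')) ^ (n - l) * (n.choose l : ℝ))) := by
      intro l hl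
      have hl' : l ≤ n := by
        have := Finset.mem_range.1 hl
        omega
      have hn : n = n - l + l := by omega
      rw [lossKraus_eq, lossKraus_eq, if_pos hn, if_pos hn, ← hn,
        enorm_ofReal_mul_of_nonneg (by positivity) (by positivity),
        ← ENNReal.ofReal_mul (by positivity)]
      congr 1
      rw [Real.sqrt_mul hκ.1, Real.sqrt_mul (by linarith [hκ.2])]
      nth_rw 3 [← Real.mul_self_sqrt (Nat.cast_nonneg (n.choose l))]
      ring
    rw [Finset.sum_congr rfl h2, ← ENNReal.ofReal_sum_of_nonneg (fun l _ => by positivity),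
      ← Finset.mul_sum, ← add_pow, add_comm (√((1 - κ) * (1 - κ')))]
  · intro l hl
    have := Finset.mem_range.not.1 hl
    -- For l > n the truncated n - l is 0, so n ≠ (n - l) + l and the amplitude vanishes.
    rw [lossKraus_eq, if_neg (by omega)]
    simp

theorem tsum_cascadeKraus_overlap {G G' κ κ' : ℝ} (hG : 1 ≤ G) (hG' : 1 ≤ G')
    (hκ : κ ∈ Set.Icc (0 : ℝ) 1) (n : Fin M → ℕ) :
    ∑' i, ∑' m, ‖cascadeKraus G κ M i m n‖ₑ * ‖cascadeKraus G' κ' M i m n‖ₑ =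
      ENNReal.ofReal (nu G G' ^ M *
        (nu G G' * √(κ * κ') + √((1 - κ) * (1 - κ'))) ^ ∑ s, n s) := by
  have hν := (nu_pos hG hG').le
  have hc : ∀ (K : (ℕ × ℕ) → ℕ → ℕ → ℂ) i m, ‖tensorKraus K M i m n‖ₑ =
      ∏ s, ‖K (i s) (m s) (n s)‖ₑ := fun K i m => by
    simp only [tensorKraus, ← ofReal_norm, norm_prod]
    rw [ENNReal.ofReal_prod_of_nonneg fun _ _ => norm_nonneg _]
  simp_rw [cascadeKraus, hc, ← Finset.prod_mul_distrib]
  have h1 : ∀ i : Fin M → ℕ × ℕ, _ := fun i => tsum_pi_prod fun s m =>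
    ‖compKraus (ampKraus G) (lossKraus κ) (i s) m (n s)‖ₑ *
      ‖compKraus (ampKraus G') (lossKraus κ') (i s) m (n s)‖ₑ
  rw [tsum_congr h1, tsum_pi_prod fun s i => ∑' m,
    ‖compKraus (ampKraus G) (lossKraus κ) i m (n s)‖ₑ *
      ‖compKraus (ampKraus G') (lossKraus κ') i m (n s)‖ₑ]
  simp_rw [tsum_compKraus_overlap hG hG' hκ]
  rw [← ENNReal.ofReal_prod_of_nonneg fun s _ => by positivity, Finset.prod_mul_distrib,
    Finset.prod_pow_eq_pow_sum]
  simp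

/-- The Fock amplitudes of both dilations are nonnegative reals, so overlaps can be computed from
norms alone. -/
theorem cascadeKraus_eq_norm {G κ : ℝ} (hG : 1 ≤ G) (i : Fin M → ℕ × ℕ) (m n : Fin M → ℕ) :
    cascadeKraus G κ M i m n = (‖cascadeKraus G κ M i m n‖ : ℂ) := by
  have hG0 : 0 < G := by linarith
  have hr : ∀ {z : ℂ}, (∃ x : ℝ, 0 ≤ x ∧ z = x) → z = (‖z‖ : ℂ) := by
    rintro _ ⟨x, hx, rfl⟩
    rw [Complex.norm_of_nonneg hx]
  have h : ∀ s, compKraus (ampKraus G) (lossKraus κ) (i s) (m s) (n s) =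
      (‖compKraus (ampKraus G) (lossKraus κ) (i s) (m s) (n s)‖ : ℂ) := by
    intro s
    rw [compKraus_eq, norm_mul, Complex.ofReal_mul]
    congr 1
    · apply hr
      rw [ampKraus_eq hG]
      split_ifs
      · exact ⟨_, by positivity, rfl⟩
      · exact ⟨0, le_rfl, by simp⟩
    · apply hr
      rw [lossKraus_eq]
      split_ifs
      · exact ⟨_, by positivity, rfl⟩
      · exact ⟨0, le_rfl, by simp⟩
  rw [cascadeKraus, tensorKraus, norm_prod, Complex.ofReal_prod]
  exact Finset.prod_congr rfl fun s _ => h s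

/-- The overlaps of the Kraus images of an NDS probe under two cascaded channels. -/
theorem tsum_ofReal_re_inner_cascade (P : NDSProbe H M) {G G' κ κ' : ℝ} (hG : 1 ≤ G)
    (hG' : 1 ≤ G') (hκ : κ ∈ Set.Icc (0 : ℝ) 1) (hκ' : κ' ∈ Set.Icc (0 : ℝ) 1) :
    ∑' i, ENNReal.ofReal (⟪idTensorOp H (cascadeKraus G κ M i) P.ket,
        idTensorOp H (cascadeKraus G' κ' M i) P.ket⟫_ℂ).re =
      ∑' N, ENNReal.ofReal (nu G G' ^ M * (P.totalPMF N *
        (nu G G' * √(κ * κ') + √((1 - κ) * (1 - κ'))) ^ N)) := by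
  have hν := (nu_pos hG hG').le
  simp_rw [fun i => (ofReal_re_inner_apply_ket P (isIdTensor_cascade H hG hκ M i)
    (isIdTensor_cascade H hG' hκ' M i) (cascadeKraus_eq_norm hG i)
    (cascadeKraus_eq_norm hG' i)).2]
  rw [ENNReal.tsum_comm]
  simp_rw [ENNReal.tsum_mul_left, tsum_cascadeKraus_overlap hG hG' hκ]
  rw [tsum_eq_tsum_sum_piAntidiag]
  refine tsum_congr fun N => ?_
  rw [NDSProbe.totalPMF, Finset.sum_mul, Finset.mul_sum, ENNReal.ofReal_sum_of_nonneg]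
  · refine Finset.sum_congr rfl fun n hn => ?_
    rw [(Finset.mem_piAntidiag.1 hn).1, ← ENNReal.ofReal_mul (P.p_nonneg n)]
    congr 1
    ring
  · intro n _
    have := P.p_nonneg n
    positivity

/-- Trace preservation, read off the overlap formula with the two channels equal: ν and the base of
the power are both 1, so the norms squared sum to ∑ p_n = 1. -/
theorem summable_norm_sq_cascade (P : NDSProbe H M) {G κ : ℝ} (hG : 1 ≤ G)
    (hκ : κ ∈ Set.Icc (0 : ℝ) 1) :
    Summable fun i => ‖idTensorOp H (cascadeKraus G κ M i) P.ket‖ ^ 2 := by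
  have h := tsum_ofReal_re_inner_cascade P hG hG hκ hκ
  have hν : nu G G = 1 := by
    rw [nu, Real.sqrt_mul_self (by linarith), Real.sqrt_mul_self (by linarith)]
    norm_num
  have hμ : nu G G * √(κ * κ) + √((1 - κ) * (1 - κ)) = 1 := by
    rw [hν, Real.sqrt_mul_self hκ.1, Real.sqrt_mul_self (by linarith [hκ.2])]
    ring
  have h1 : ∑' N, ENNReal.ofReal (P.totalPMF N) = 1 := by
    simp_rw [NDSProbe.totalPMF,
      fun N => ENNReal.ofReal_sum_of_nonneg (s := Finset.piAntidiag Finset.univ N)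
        (fun n _ => P.p_nonneg n)]
    rw [← tsum_eq_tsum_sum_piAntidiag fun n => ENNReal.ofReal (P.p n),
      ← ENNReal.ofReal_tsum_of_nonneg P.p_nonneg P.p_hasSum.summable, P.p_hasSum.tsum_eq,
      ENNReal.ofReal_one]
  simp only [hμ] at h
  simp only [hν, one_pow, mul_one, one_mul, h1] at h
  have h2 := ENNReal.summable_toReal (ne_of_eq_of_ne h ENNReal.one_ne_top)
  refine h2.congr fun i => ?_
  rw [← RCLike.re_eq_complex_re, ← norm_sq_eq_re_inner, ENNReal.toReal_ofReal (sq_nonneg _)]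

theorem applyChannel_state [CompleteSpace H] (P : NDSProbe H M) {ι : Type*}
    (K : ι → (Fin M → ℕ) → (Fin M → ℕ) → ℂ) :
    applyChannel K P.state = ∑' i, InnerProductSpace.rankOne ℂ (idTensorOp H (K i) P.ket)
      (idTensorOp H (K i) P.ket) := by
  refine tsum_congr fun i => ?_
  rw [NDSProbe.state, InnerProductSpace.rankOne_comp, InnerProductSpace.comp_rankOne,
    ContinuousLinearMap.adjoint_adjoint]

end Overlap

end Bosonic

end

theorem mainTheorem2 {H : Type*} [NormedAddCommGroup H] [InnerProductSpace ℂ H] [CompleteSpace H]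
    (M : ℕ) (G G' κ κ' : ℝ) (hG : 1 ≤ G) (hG' : 1 ≤ G')
    (hκ : κ ∈ Set.Icc (0 : ℝ) 1) (hκ' : κ' ∈ Set.Icc (0 : ℝ) 1)
    (P : Bosonic.NDSProbe H M) :
    Bosonic.nu G G' ^ M *
        ∑' n : ℕ, P.totalPMF n *
          (Bosonic.nu G G' * √(κ * κ') + √((1 - κ) * (1 - κ'))) ^ n ≤
      Bosonic.fidelity
        (Bosonic.applyChannel (Bosonic.cascadeKraus G κ M) P.state)
        (Bosonic.applyChannel (Bosonic.cascadeKraus G' κ' M) P.state) := by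
  have hν := (Bosonic.nu_pos hG hG').le
  have h := congrArg ENNReal.toReal (Bosonic.tsum_ofReal_re_inner_cascade P hG hG' hκ hκ')
  -- Finiteness of each term is enough for `toReal` to pass through the sums.
  rw [ENNReal.tsum_toReal_eq fun _ => ENNReal.ofReal_ne_top,
    ENNReal.tsum_toReal_eq fun _ => ENNReal.ofReal_ne_top] at h
  rw [Bosonic.applyChannel_state, Bosonic.applyChannel_state]
  refine le_trans (le_of_eq ?_) (Bosonic.tsum_re_inner_le_fidelity_rankOne _ _
    (Bosonic.summable_norm_sq_cascade P hG hκ) (Bosonic.summable_norm_sq_cascade P hG' hκ'))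
  rw [← tsum_mul_left]
  refine Eq.trans ?_ (h.symm.trans ?_) <;> refine tsum_congr fun i => ?_
  · rw [ENNReal.toReal_ofReal]
    have : 0 ≤ P.totalPMF i := Finset.sum_nonneg fun n _ => P.p_nonneg n
    positivity
  · exact ENNReal.toReal_ofReal (Bosonic.ofReal_re_inner_apply_ket P
      (Bosonic.isIdTensor_cascade H hG hκ M i) (Bosonic.isIdTensor_cascade H hG' hκ' M i)
      (Bosonic.cascadeKraus_eq_norm hG i) (Bosonic.cascadeKraus_eq_norm hG' i)).1
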